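/- Let $\mathbb{F}$ be a field with exactly three elements and let $s$ be a symplectic form (nondegenerate alternating bilinear form) on a finite-dimensional $\mathbb{F}$-vector space $V$, with symplectic group $\mathrm{Sp}(s)=\{u\in \mathrm{GL}(V) : s(u(x),u(y))=s(x,y)\ \text{for all } x,y\in V\}$. An element of a group $G$ is called $k$-reflectional if it is the product of $k$ elements $i\in G$ satisfying $i^2=1$. (1) Let $\eta\in\{1,-1\}$ and let $u\in\mathrm{Sp}(s)$ be cyclic (i.e. $V$ is spanned by $x,u(x),u^2(x),\dots$ for some $x\in V$) with minimal polynomial $(t^2+1)(t-\eta)^2$. Then $u$ is not $4$-reflectional in $\mathrm{Sp}(s)$. (2) If $\dim V=4$, then for each $\eta\in\{1,-1\}$ there exists $u\in\mathrm{Sp}(s)$ that is cyclic with minimal polynomial $(t^2+1)(t-\eta)^2$. Hence $\mathrm{Sp}(s)$ contains elements that are not $4$-reflectional, and the least integer $\ell_4(\mathbb{F})$ (or $+\infty$ if there is none) such that every element of $\mathrm{Sp}(s)$ is $\ell_4(\mathbb{F})$-reflectional satisfies $\ell_4(\mathbb{F})>4$. -/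

import Mathlib

open Polynomial

/-- The symplectic group `Sp(s)`: the linear automorphisms of `V` that preserve the form `s`. -/
def symplecticGroupOf {F V : Type*} [Field F] [AddCommGroup V] [Module F V]
    (s : LinearMap.BilinForm F V) : Subgroup (V ≃ₗ[F] V) where
  carrier := {u | ∀ x y, s (u x) (u y) = s x y}
  one_mem' := fun _ _ => rfl
  mul_mem' := by
    intro a b ha hb x y
    exact (ha (b x) (b y)).trans (hb x y)
  inv_mem' := by
    intro a ha x y
    have h := ha (a⁻¹ x) (a⁻¹ y)
    have e : ∀ z, a (a⁻¹ z) = z := fun z => a.apply_symm_apply z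
    rw [e, e] at h
    exact h.symm

/-- A symplectic form: a nondegenerate alternating bilinear form. -/
def IsSymplecticForm {F V : Type*} [Field F] [AddCommGroup V] [Module F V]
    (s : LinearMap.BilinForm F V) : Prop :=
  s.IsAlt ∧ s.Nondegenerate

/-- `g` is a product of `k` involutions of `G`, an involution being an element of order
`1` or `2`. -/
def IsReflectional {G : Type*} [Group G] (k : ℕ) (g : G) : Prop :=
  ∃ i : Fin k → G, (∀ j, i j ^ 2 = 1) ∧ (List.ofFn i).prod = g

/-- The least `k` such that every element of `G` is a product of `k` involutions, or `⊤` if there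
is no such `k`. -/
noncomputable def involutionLength (G : Type*) [Group G] : ℕ∞ :=
  sInf {m : ℕ∞ | ∃ k : ℕ, m = k ∧ ∀ g : G, IsReflectional k g}

/-- An endomorphism `f` is cyclic if `V` is generated by the iterates of some vector. -/
def IsCyclicEnd {F V : Type*} [Field F] [AddCommGroup V] [Module F V]
    (f : Module.End F V) : Prop :=
  ∃ x : V, Submodule.span F (Set.range fun n : ℕ => (f ^ n) x) = ⊤

/-- `f` is cyclic with minimal polynomial `(t ^ 2 + 1) (t - η) ^ 2`. -/
def IsExceptionalCyclic {F V : Type*} [Field F] [AddCommGroup V] [Module F V]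
    (η : F) (f : Module.End F V) : Prop :=
  IsCyclicEnd f ∧ minpoly F f = (X ^ 2 + 1) * (X - C η) ^ 2

/-! Since `-1` is a central involution, `u` may be replaced by `v = ηu`, annihilated by `(t² + 1)(t
- 1)²`. Cyclicity makes `V` an orthogonal sum of two planes on which `v` is a quarter turn and a
transvection (`exists_isAdapted`). After identifying the field with `ZMod 3`, the claim concerns one
matrix and the forms `gram ε δ`.

Symplectic involutions are self-adjoint, and in dimension 4 two noncentral ones have a scalar
anticommutator. Let `v = ABCD`. If a factor is `±1`, then `v` is a product of three involutions,
which `turnTransvection_ne_mul_three` excludes. Otherwise put `a = AB`, `AB + BA = α` and `CD + DC =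
β`. Then `BA = α - a` is both the adjoint and the inverse of `a`, and `CD = (α - a)v`, `DC = v⁻¹a`.
The linear equation `(α - a)v + v⁻¹a = β` makes `a` block diagonal, leaving few parameters.

The obstruction is quadratic: `A` negates the symmetric form of matrix `gram * (a + α)`, and `C`
that of `gram * (CD + β)`. A nonzero form that is anisotropic modulo its radical cannot be negated
by an involution. With the equation `a(α - a) = 1`, this rules out every parameter
(`involution_parameters_contradiction`).

For existence, the model is written down in a symplectic basis. -/

namespace ExceptionalSymplectic

open Matrix

/-! ### Self-adjoint matrices and anticommutators of involutions -/

/-- The Gram matrix of an orthogonal sum of two planes with alternating forms. -/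
def gram (ε δ : ZMod 3) : Matrix (Fin 4) (Fin 4) (ZMod 3) :=
  !![0, ε, 0, 0; -ε, 0, 0, 0; 0, 0, 0, δ; 0, 0, -δ, 0]

/-- The direct sum of a quarter turn and a transvection. -/
def turnTransvection : Matrix (Fin 4) (Fin 4) (ZMod 3) :=
  !![0, -1, 0, 0; 1, 0, 0, 0; 0, 0, 1, 0; 0, 0, 1, 1]

/-- Symplectic involutions, in matrix form. -/
def IsSymplecticInvolution (ε δ : ZMod 3) (M : Matrix (Fin 4) (Fin 4) (ZMod 3)) : Prop :=
  M * M = 1 ∧ Mᵀ * gram ε δ * M = gram ε δ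

theorem eq_zero_of_eq_neg : ∀ {x : ZMod 3}, x = -x → x = 0 := by decide

theorem sq_eq_one_of_ne_zero : ∀ {ε : ZMod 3}, ε ≠ 0 → ε * ε = 1 := by decide

variable {ε δ : ZMod 3} {M N : Matrix (Fin 4) (Fin 4) (ZMod 3)}

theorem IsSymplecticInvolution.selfAdjoint (h : IsSymplecticInvolution ε δ M) :
    Mᵀ * gram ε δ = gram ε δ * M := by
  have := congrArg (· * M) h.2
  simpa [Matrix.mul_assoc, h.1] using this

/-- The shape of a self-adjoint matrix. -/
theorem selfAdjoint_shape (hε : ε ≠ 0) (hδ : δ ≠ 0)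
    (h : Mᵀ * gram ε δ = gram ε δ * M) :
    ∃ P R w x y z : ZMod 3, M = !![P, 0, w, x; 0, P, y, z;
      ε * δ * z, -(ε * δ * x), R, 0; -(ε * δ * y), ε * δ * w, 0, R] := by
  have h1 := sq_eq_one_of_ne_zero hε
  have h2 := sq_eq_one_of_ne_zero hδ
  have E := fun i j => congrFun (congrFun h i) j
  simp only [Matrix.mul_apply, Fin.sum_univ_four, gram, Matrix.transpose_apply] at E
  refine ⟨M 0 0, M 2 2, M 0 2, M 0 3, M 1 2, M 1 3, ?_⟩
  have e00 := E 0 0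
  have e01 := E 0 1
  have e11 := E 1 1
  have e22 := E 2 2
  have e23 := E 2 3
  have e33 := E 3 3
  have e02 := E 0 2
  have e03 := E 0 3
  have e12 := E 1 2
  have e13 := E 1 3
  clear E h
  simp at e00 e01 e11 e22 e23 e33 e02 e03 e12 e13
  -- Self-adjointness makes `gram ε δ * M` skew-symmetric, so its diagonal vanishes.
  have f10 : ε * M 1 0 = 0 := eq_zero_of_eq_neg (by grind)
  have f01 : ε * M 0 1 = 0 := eq_zero_of_eq_neg (by grind)
  have f32 : δ * M 3 2 = 0 := eq_zero_of_eq_neg (by grind)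
  have f23 : δ * M 2 3 = 0 := eq_zero_of_eq_neg (by grind)
  ext i j
  fin_cases i <;> fin_cases j <;> simp <;> grind

/-- The off-diagonal blocks of `M * M` are those of `M` times `P + R`. So either `R = -P`, or these
blocks vanish and `M = ±1`. -/
theorem IsSymplecticInvolution.noncentral_shape (hε : ε ≠ 0) (hδ : δ ≠ 0)
    (h : IsSymplecticInvolution ε δ M) (hM1 : M ≠ 1) (hM2 : M ≠ -1) :
    ∃ P w x y z : ZMod 3, M = !![P, 0, w, x; 0, P, y, z;
      ε * δ * z, -(ε * δ * x), -P, 0; -(ε * δ * y), ε * δ * w, 0, -P] := by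
  obtain ⟨P, R, w, x, y, z, rfl⟩ := selfAdjoint_shape hε hδ h.selfAdjoint
  have h1 := sq_eq_one_of_ne_zero hε
  have h2 := sq_eq_one_of_ne_zero hδ
  have E := fun i j => congrFun (congrFun h.1 i) j
  by_cases hPR : P + R = 0
  · exact ⟨P, w, x, y, z, by rw [eq_neg_of_add_eq_zero_right hPR]⟩
  exfalso
  simp only [Matrix.mul_apply, Fin.sum_univ_four] at E
  have e00 := E 0 0
  have e02 := E 0 2
  have e03 := E 0 3
  have e12 := E 1 2
  have e13 := E 1 3
  have e22 := E 2 2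
  clear E
  simp at e00 e02 e03 e12 e13 e22
  have hw : w = 0 := by grind
  have hx : x = 0 := by grind
  have hy : y = 0 := by grind
  have hz : z = 0 := by grind
  have hR : R = P := by grind
  subst hw hx hy hz hR
  have hP : R = 1 ∨ R = -1 := by grind
  rcases hP with rfl | rfl
  · apply hM1
    ext i j
    fin_cases i <;> fin_cases j <;> simp
  · apply hM2
    ext i j
    fin_cases i <;> fin_cases j <;> simp

theorem anticommutator_eq_scalar (hε : ε ≠ 0) (hδ : δ ≠ 0)
    (hM : IsSymplecticInvolution ε δ M) (hM1 : M ≠ 1) (hM2 : M ≠ -1)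
    (hN : IsSymplecticInvolution ε δ N) (hN1 : N ≠ 1) (hN2 : N ≠ -1) :
    ∃ α : ZMod 3, M * N + N * M = α • 1 := by
  obtain ⟨P, w, x, y, z, rfl⟩ := hM.noncentral_shape hε hδ hM1 hM2
  obtain ⟨P', w', x', y', z', rfl⟩ := hN.noncentral_shape hε hδ hN1 hN2
  -- Matrices of this shape square to the scalar `P² + εδ(wz - xy)`; this is the polarization of
  -- that quadratic form.
  refine ⟨2 * P * P' + ε * δ * (w * z' + w' * z - x * y' - x' * y), ?_⟩
  ext i j
  fin_cases i <;> fin_cases j <;> simp <;> ring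

/-! ### Symmetric forms negated by an involution -/

/-- A form that is anisotropic modulo its radical and is negated by an involution vanishes. -/
theorem eq_zero_of_negated_of_anisotropic {H : Matrix (Fin 4) (Fin 4) (ZMod 3)}
    (hM : M * M = 1) (hH : Mᵀ * H * M = -H)
    (han : ∀ x, x ⬝ᵥ H *ᵥ x = 0 → H *ᵥ x = 0) : H = 0 := by
  -- On an eigenvector of `M` the quadratic form equals its own negative, so it vanishes; the
  -- eigenvectors `x ± Mx` then span.
  have hfix : ∀ x, (M *ᵥ x = x ∨ M *ᵥ x = -x) → H *ᵥ x = 0 := by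
    intro x hx
    apply han
    have h1 : (M *ᵥ x) ⬝ᵥ H *ᵥ (M *ᵥ x) = -(x ⬝ᵥ H *ᵥ x) := by
      have h := congrArg (fun A => x ⬝ᵥ A *ᵥ x) hH
      simp only [← Matrix.mulVec_mulVec, Matrix.dotProduct_mulVec x Mᵀ, Matrix.vecMul_transpose,
        Matrix.neg_mulVec, dotProduct_neg] at h
      exact h
    have h2 : (M *ᵥ x) ⬝ᵥ H *ᵥ (M *ᵥ x) = x ⬝ᵥ H *ᵥ x := by
      rcases hx with hx | hx <;> simp [hx, Matrix.mulVec_neg]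
    exact eq_zero_of_eq_neg (h2.symm.trans h1)
  have hzero : ∀ x, H *ᵥ x = 0 := by
    intro x
    have hMM : M *ᵥ (M *ᵥ x) = x := by rw [Matrix.mulVec_mulVec, hM, Matrix.one_mulVec]
    have hp := hfix (x + M *ᵥ x) (Or.inl (by rw [Matrix.mulVec_add, hMM, add_comm]))
    have hm := hfix (x - M *ᵥ x) (Or.inr (by rw [Matrix.mulVec_sub, hMM, neg_sub]))
    rw [Matrix.mulVec_add] at hp
    rw [Matrix.mulVec_sub] at hm
    funext i
    have h1 := congrFun hp i
    have h2 := congrFun hm i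
    simp only [Pi.add_apply, Pi.sub_apply, Pi.zero_apply] at h1 h2 ⊢
    exact eq_zero_of_eq_neg ((sub_eq_zero.mp h2).trans (eq_neg_of_add_eq_zero_right h1))
  ext i j
  simpa using congrFun (hzero (Pi.single j 1)) i

/-- The Gram matrix of an orthogonal sum of two binary symmetric forms. -/
def blockForm (p q r k l t : ZMod 3) : Matrix (Fin 4) (Fin 4) (ZMod 3) :=
  !![p, q, 0, 0; q, r, 0, 0; 0, 0, k, l; 0, 0, l, t]

/-- The nonzero value (if any) of a degenerate binary form with diagonal entries `p` and `r`. -/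
def diagValue (p r : ZMod 3) : ZMod 3 := p + r - p ^ 2 * r

/-- A form of rank at most one is a constant times the square of a linear form, and 1 is the only
nonzero square of `ZMod 3`. -/
theorem degenerate_binary_form : ∀ p q r : ZMod 3, p * r = q ^ 2 → ∀ x y : ZMod 3,
    (x * (p * x + q * y) + y * (q * x + r * y) = diagValue p r ∨
      x * (p * x + q * y) + y * (q * x + r * y) = 0) ∧
    (x * (p * x + q * y) + y * (q * x + r * y) = 0 → p * x + q * y = 0 ∧ q * x + r * y = 0) := by
  unfold diagValue; decide

/-- Two values from `{0, c}` and `{0, d}` with `c + d ≠ 0` sum to zero only if both are zero,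
because in `ZMod 3` two nonzero elements are equal or opposite. The sum is then anisotropic modulo
its radical. -/
theorem diagValue_add_eq_zero {p q r k l t : ZMod 3} (h1 : p * r = q ^ 2) (h2 : k * t = l ^ 2)
    (hM : M * M = 1) (hH : Mᵀ * blockForm p q r k l t * M = -blockForm p q r k l t) :
    diagValue p r + diagValue k t = 0 := by
  by_contra hne
  have hz : blockForm p q r k l t = 0 := by
    refine eq_zero_of_negated_of_anisotropic hM hH fun x hx => ?_
    obtain ⟨a1, b1⟩ := degenerate_binary_form p q r h1 (x 0) (x 1)
    obtain ⟨a2, b2⟩ := degenerate_binary_form k l t h2 (x 2) (x 3)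
    simp [blockForm, dotProduct, Matrix.mulVec, Fin.sum_univ_four] at hx
    have hA : x 0 * (p * x 0 + q * x 1) + x 1 * (q * x 0 + r * x 1) = 0 := by grind
    have hB : x 2 * (k * x 2 + l * x 3) + x 3 * (l * x 2 + t * x 3) = 0 := by grind
    obtain ⟨c1, c2⟩ := b1 hA
    obtain ⟨c3, c4⟩ := b2 hB
    funext i
    fin_cases i <;> simp [blockForm, dotProduct, Matrix.mulVec, Fin.sum_univ_four, *]
  have e := fun i => congrFun (congrFun hz i) i
  have e0 : p = 0 := e 0
  have e1 : r = 0 := e 1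
  have e2 : k = 0 := e 2
  have e3 : t = 0 := e 3
  apply hne
  rw [e0, e1, e2, e3]
  rfl

end ExceptionalSymplectic

/-! ### Excluding products of three and four involutions -/

namespace ExceptionalSymplectic

open Matrix

variable {ε δ : ZMod 3}

theorem IsSymplecticInvolution.transpose_mul_gram {B C : Matrix (Fin 4) (Fin 4) (ZMod 3)}
    (hB : IsSymplecticInvolution ε δ B) (hC : IsSymplecticInvolution ε δ C) :
    (B * C)ᵀ * gram ε δ = gram ε δ * (C * B) := by
  rw [transpose_mul, Matrix.mul_assoc, hB.selfAdjoint, ← Matrix.mul_assoc, hC.selfAdjoint,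
    Matrix.mul_assoc]

theorem IsSymplecticInvolution.neg {B : Matrix (Fin 4) (Fin 4) (ZMod 3)}
    (hB : IsSymplecticInvolution ε δ B) : IsSymplecticInvolution ε δ (-B) := by
  refine ⟨by simpa using hB.1, by simpa using hB.2⟩

theorem selfAdjoint_column_eq_zero {A : Matrix (Fin 4) (Fin 4) (ZMod 3)}
    (hε : ε ≠ 0) (hδ : δ ≠ 0) (hA : Aᵀ * gram ε δ = gram ε δ * A)
    (h : (∃ β : ZMod 3, gram ε δ * A * turnTransvection + turnTransvectionᵀ * gram ε δ * A =
        β • gram ε δ) ∨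
      gram ε δ * A * turnTransvection = turnTransvectionᵀ * gram ε δ * A) :
    ∀ i, A i 3 = 0 := by
  obtain ⟨P, R, w, x, y, z, rfl⟩ := selfAdjoint_shape hε hδ hA
  have h1 := sq_eq_one_of_ne_zero hε
  have h2 := sq_eq_one_of_ne_zero hδ
  suffices hs : R = 0 ∧ x = 0 ∧ z = 0 by
    obtain ⟨rfl, rfl, rfl⟩ := hs
    intro i
    fin_cases i <;> simp
  rcases h with ⟨β, h⟩ | h
  · have E := fun i j => congrFun (congrFun h i) j
    have e01 := E 0 1
    have e23 := E 2 3
    have e03 := E 0 3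
    have e13 := E 1 3
    clear E h hA
    simp [gram, turnTransvection, Matrix.mul_apply, Fin.sum_univ_four] at e01 e23 e03 e13
    have hR : δ * R = 0 := eq_zero_of_eq_neg (by grind)
    have hx : ε * x = 0 := eq_zero_of_eq_neg (by grind)
    have hz : ε * z = 0 := eq_zero_of_eq_neg (by grind)
    grind
  · have E := fun i j => congrFun (congrFun h i) j
    have e22 := E 2 2
    have e03 := E 0 3
    have e13 := E 1 3
    clear E h hA
    simp [gram, turnTransvection, Matrix.mul_apply, Fin.sum_univ_four] at e22 e03 e13
    have hR : δ * R = 0 := eq_zero_of_eq_neg (by grind)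
    have hx : ε * x = 0 := eq_zero_of_eq_neg (by grind)
    have hz : ε * z = 0 := eq_zero_of_eq_neg (by grind)
    grind

/-- Here `BC = Av` and `CB = v⁻¹A`. Either `B` and `C` commute, or both are noncentral and `BC + CB`
is scalar; each linear condition kills a column of the invertible `A`. -/
theorem turnTransvection_ne_mul_three {A B C : Matrix (Fin 4) (Fin 4) (ZMod 3)}
    (hε : ε ≠ 0) (hδ : δ ≠ 0) (hA : IsSymplecticInvolution ε δ A)
    (hB : IsSymplecticInvolution ε δ B) (hC : IsSymplecticInvolution ε δ C) :
    A * B * C ≠ turnTransvection := by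
  intro h
  have hBC : B * C = A * turnTransvection := by
    rw [← h, Matrix.mul_assoc, ← Matrix.mul_assoc A A, hA.1, Matrix.one_mul]
  have hCB : gram ε δ * (C * B) = turnTransvectionᵀ * gram ε δ * A := by
    rw [← hB.transpose_mul_gram hC, hBC, transpose_mul, Matrix.mul_assoc, hA.selfAdjoint,
      Matrix.mul_assoc]
  have hcol : ∀ i, A i 3 = 0 := by
    refine selfAdjoint_column_eq_zero hε hδ hA.selfAdjoint ?_
    by_cases hcomm : B * C = C * B
    · right
      rw [← hCB, ← hcomm, hBC, Matrix.mul_assoc]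
    · left
      have ne : B ≠ 1 ∧ B ≠ -1 ∧ C ≠ 1 ∧ C ≠ -1 := by
        refine ⟨?_, ?_, ?_, ?_⟩ <;> rintro rfl <;> simp at hcomm
      obtain ⟨β, hβ⟩ := anticommutator_eq_scalar hε hδ hB ne.1 ne.2.1 hC ne.2.2.1 ne.2.2.2
      refine ⟨β, ?_⟩
      rw [← hCB, Matrix.mul_assoc, ← hBC, ← Matrix.mul_add, hβ]
      simp
  have := congrFun (congrFun hA.1 3) 3
  simp [Matrix.mul_apply, hcol] at this

/-- The matrix `a` such that `gram ε δ * (a + α • 1) = blockForm p q r k l t`. -/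
def formElement (ε δ α p q r k l t : ZMod 3) : Matrix (Fin 4) (Fin 4) (ZMod 3) :=
  !![-ε * q - α, -ε * r, 0, 0; ε * p, ε * q - α, 0, 0;
    0, 0, -δ * l - α, -δ * t; 0, 0, δ * k, δ * l - α]

theorem formElement_shape {a : Matrix (Fin 4) (Fin 4) (ZMod 3)} {α β : ZMod 3}
    (hε : ε ≠ 0) (hδ : δ ≠ 0) (ha : aᵀ * gram ε δ = gram ε δ * (α • 1 - a))
    (h : gram ε δ * (α • 1 - a) * turnTransvection + turnTransvectionᵀ * gram ε δ * a =
        β • gram ε δ) :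
    ∃ p q k l, a = formElement ε δ α p q (β * ε - p) k l ((β - α) * δ) := by
  have h1 := sq_eq_one_of_ne_zero hε
  have h2 := sq_eq_one_of_ne_zero hδ
  have E := fun i j => congrFun (congrFun ha i) j
  have G := fun i j => congrFun (congrFun h i) j
  have e01 := E 0 1
  have e23 := E 2 3
  have e02 := E 0 2
  have e03 := E 0 3
  have e12 := E 1 2
  have e13 := E 1 3
  have g01 := G 0 1
  have g23 := G 2 3
  have g02 := G 0 2
  have g03 := G 0 3
  have g12 := G 1 2
  have g13 := G 1 3
  clear E G h ha
  simp [gram, turnTransvection, Matrix.mul_apply, Fin.sum_univ_four, Matrix.vecMul, dotProduct,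
    Matrix.one_apply] at e01 e23 e02 e03 e12 e13 g01 g23 g02 g03 g12 g13
  have z03 : ε * a 0 3 = 0 := eq_zero_of_eq_neg (by grind)
  have z13 : ε * a 1 3 = 0 := eq_zero_of_eq_neg (by grind)
  have z02 : ε * a 0 2 = 0 := eq_zero_of_eq_neg (by grind)
  have z12 : ε * a 1 2 = 0 := eq_zero_of_eq_neg (by grind)
  have f0 : a 0 0 = α - a 1 1 := by grind
  have f1 : a 2 2 = α - a 3 3 := by grind
  have z20 : a 2 0 = 0 := by grind
  have z21 : a 2 1 = 0 := by grind
  have z30 : a 3 0 = 0 := by grind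
  have z31 : a 3 1 = 0 := by grind
  have y02 : a 0 2 = 0 := by grind
  have y03 : a 0 3 = 0 := by grind
  have y12 : a 1 2 = 0 := by grind
  have y13 : a 1 3 = 0 := by grind
  have h3 : (3 : ZMod 3) = 0 := rfl
  -- These are entries of `gram ε δ * (a + α • 1)`.
  refine ⟨ε * a 1 0, ε * (a 1 1 + α), δ * a 3 2, δ * (a 3 3 + α), ?_⟩
  ext i j
  fin_cases i <;> fin_cases j <;> simp [formElement, *]
  · linear_combination (a 1 1 + α) * h1 + α * h3
  · linear_combination -a 0 1 * h1 - ε * g01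
  · linear_combination -a 1 0 * h1
  · linear_combination -(a 1 1 + α) * h1
  · linear_combination (a 3 3 + α) * h2 + α * h3
  · linear_combination -a 2 3 * h2 - δ * g23
  · linear_combination -a 3 2 * h2
  · linear_combination -(a 3 3 + α) * h2

/-- A finite check. Hypotheses are interleaved with the quantifiers so that the search is pruned
early. -/
theorem involution_parameters_contradiction : ∀ α β ε : ZMod 3, ε ≠ 0 → ∀ δ : ZMod 3, δ ≠ 0 →
    ∀ p q : ZMod 3, p * (β * ε - p) - q ^ 2 = 1 - α ^ 2 →
    ∀ k l : ZMod 3, k * ((β - α) * δ) - l ^ 2 = 1 - α ^ 2 →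
    (α ≠ 0 → diagValue p (β * ε - p) + diagValue k ((β - α) * δ) = 0) →
    (β ≠ 0 → (-α * ε - q) * (-α * ε + q) = (β * ε + p) ^ 2 →
      (-α * δ - k - l) * (-((β - α) * δ)) = ((β - α) * δ - l) ^ 2 →
      diagValue (-α * ε - q) (-α * ε + q) + diagValue (-α * δ - k - l) (-((β - α) * δ)) = 0) →
    False := by
  unfold diagValue
  decide +kernel

theorem gram_mul_formElement_add (hε : ε ≠ 0) (hδ : δ ≠ 0) (α p q r k l t : ZMod 3) :
    gram ε δ * (formElement ε δ α p q r k l t + α • 1) = blockForm p q r k l t := by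
  have h1 := sq_eq_one_of_ne_zero hε
  have h2 := sq_eq_one_of_ne_zero hδ
  ext i j
  fin_cases i <;> fin_cases j <;> simp [gram, formElement, blockForm, Matrix.mul_apply,
    Fin.sum_univ_four, Matrix.one_apply] <;> grind

/-- If two involutions `A` and `B` have a scalar anticommutator, then the symmetric form attached
to `A * B` is negated by `A`. -/
theorem negated_form {A B : Matrix (Fin 4) (Fin 4) (ZMod 3)} {α : ZMod 3}
    (hA : IsSymplecticInvolution ε δ A) (hAB : A * B + B * A = α • 1) :
    Aᵀ * (gram ε δ * (A * B + α • 1)) * A = -(gram ε δ * (A * B + α • 1)) := by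
  have h3 : (3 : ZMod 3) = 0 := rfl
  have hBA : B * A = α • 1 - A * B := eq_sub_of_add_eq' hAB
  -- As `1/2 = -1`, `AB + α` is `AB - α/2 = (AB - BA)/2`, which conjugation by `A` negates.
  have key : A * (A * B + α • 1) * A = -(A * B + α • 1) := by
    have : A * (A * B + α • 1) * A = B * A + α • 1 := by
      rw [Matrix.mul_add, ← Matrix.mul_assoc, hA.1, Matrix.one_mul, Matrix.add_mul]
      simp [hA.1]
    rw [this, hBA]
    ext i j
    simp only [Matrix.add_apply, Matrix.sub_apply, Matrix.neg_apply, Matrix.smul_apply, smul_eq_mul]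
    linear_combination α * (1 : Matrix (Fin 4) (Fin 4) (ZMod 3)) i j * h3
  rw [← Matrix.mul_assoc, hA.selfAdjoint, Matrix.mul_assoc, Matrix.mul_assoc,
    ← Matrix.mul_assoc A, key, Matrix.mul_neg]

/-- With `CD = (α - a)v`, this computes the form that `C` negates. -/
theorem scalar_sub_formElement_mul (hε : ε ≠ 0) (hδ : δ ≠ 0) (α β p q k l : ZMod 3) :
    gram ε δ * ((α • 1 - formElement ε δ α p q (β * ε - p) k l ((β - α) * δ)) * turnTransvection
        + β • 1) =
      blockForm (-α * ε - q) (β * ε + p) (-α * ε + q)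
        (-α * δ - k - l) ((β - α) * δ - l) (-((β - α) * δ)) := by
  have h1 := sq_eq_one_of_ne_zero hε
  have h2 := sq_eq_one_of_ne_zero hδ
  have h3 : (3 : ZMod 3) = 0 := rfl
  ext i j
  fin_cases i <;> fin_cases j <;> simp [gram, formElement, blockForm, Matrix.mul_apply,
    Fin.sum_univ_four, Matrix.one_apply, turnTransvection]
  · linear_combination -q * h1 + α * ε * h3
  · linear_combination p * h1
  · linear_combination (p - β * ε) * h1 - β * ε * h3
  · linear_combination q * h1 + α * ε * h3
  · linear_combination (-k - l) * h2 + α * δ * h3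
  · linear_combination -l * h2 + α * δ * h3
  · linear_combination (-l - (β - α) * δ) * h2 - β * δ * h3
  · linear_combination (β - α) * δ * h2

/-- In characteristic 3, `a(α - a) = 1` reads `(a + α)² = α² - 1`, and `a + α` has trace zero on
each plane. Both blocks are thus degenerate when `α ≠ 0`. -/
theorem formElement_det_eqs (hε : ε ≠ 0) (hδ : δ ≠ 0) {α p q r k l t : ZMod 3}
    (h : formElement ε δ α p q r k l t * (α • 1 - formElement ε δ α p q r k l t) = 1) :
    p * r - q ^ 2 = 1 - α ^ 2 ∧ k * t - l ^ 2 = 1 - α ^ 2 := by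
  have h1 := sq_eq_one_of_ne_zero hε
  have h2 := sq_eq_one_of_ne_zero hδ
  have h3 : (3 : ZMod 3) = 0 := rfl
  have e1 := congrFun (congrFun h 1) 1
  have e3 := congrFun (congrFun h 3) 3
  simp [formElement, Matrix.mul_apply, Fin.sum_univ_four, Matrix.one_apply] at e1 e3
  constructor
  · linear_combination e1 + (q ^ 2 - p * r) * h1 + (α ^ 2 - α * ε * q) * h3
  · linear_combination e3 + (l ^ 2 - k * t) * h2 + (α ^ 2 - α * δ * l) * h3

theorem turnTransvection_ne_mul_four {A B C D : Matrix (Fin 4) (Fin 4) (ZMod 3)}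
    (hε : ε ≠ 0) (hδ : δ ≠ 0) (hA : IsSymplecticInvolution ε δ A)
    (hB : IsSymplecticInvolution ε δ B) (hC : IsSymplecticInvolution ε δ C)
    (hD : IsSymplecticInvolution ε δ D) :
    A * B * C * D ≠ turnTransvection := by
  intro h
  have h3 := fun {X Y Z : Matrix (Fin 4) (Fin 4) (ZMod 3)} =>
    turnTransvection_ne_mul_three (A := X) (B := Y) (C := Z) hε hδ
  have hA1 : A ≠ 1 := by rintro rfl; exact h3 hB hC hD (by simpa using h)
  have hA2 : A ≠ -1 := by rintro rfl; exact h3 hB.neg hC hD (by simpa using h)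
  have hB1 : B ≠ 1 := by rintro rfl; exact h3 hA hC hD (by simpa using h)
  have hB2 : B ≠ -1 := by rintro rfl; exact h3 hA.neg hC hD (by simpa using h)
  have hC1 : C ≠ 1 := by rintro rfl; exact h3 hA hB hD (by simpa using h)
  have hC2 : C ≠ -1 := by rintro rfl; exact h3 hA.neg hB hD (by simpa using h)
  have hD1 : D ≠ 1 := by rintro rfl; exact h3 hA hB hC (by simpa using h)
  have hD2 : D ≠ -1 := by rintro rfl; exact h3 hA.neg hB hC (by simpa using h)
  obtain ⟨α, hα⟩ := anticommutator_eq_scalar hε hδ hA hA1 hA2 hB hB1 hB2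
  obtain ⟨β, hβ⟩ := anticommutator_eq_scalar hε hδ hC hC1 hC2 hD hD1 hD2
  have hBA : B * A = α • 1 - A * B := eq_sub_of_add_eq' hα
  have hinv : B * A * (A * B) = 1 := by
    rw [Matrix.mul_assoc, ← Matrix.mul_assoc A, hA.1, Matrix.one_mul, hB.1]
  have hinv' : A * B * (B * A) = 1 := by
    rw [Matrix.mul_assoc, ← Matrix.mul_assoc B, hB.1, Matrix.one_mul, hA.1]
  have hCD : C * D = (α • 1 - A * B) * turnTransvection := by
    rw [← h, ← hBA, Matrix.mul_assoc (A * B), ← Matrix.mul_assoc, hinv, Matrix.one_mul]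
  have hadj := hA.transpose_mul_gram hB
  have hDC : gram ε δ * (D * C) = turnTransvectionᵀ * gram ε δ * (A * B) := by
    rw [← hC.transpose_mul_gram hD, hCD, ← hBA, transpose_mul, Matrix.mul_assoc,
      hB.transpose_mul_gram hA, Matrix.mul_assoc]
  rw [hBA] at hadj hinv'
  have htw : gram ε δ * (α • 1 - A * B) * turnTransvection +
      turnTransvectionᵀ * gram ε δ * (A * B) = β • gram ε δ := by
    rw [← hDC, Matrix.mul_assoc, ← hCD, ← Matrix.mul_add, hβ]
    simp
  obtain ⟨p, q, k, l, hab⟩ := formElement_shape hε hδ hadj htw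
  have hH := negated_form hA hα
  have hH' := negated_form hC hβ
  rw [hCD, hab, scalar_sub_formElement_mul hε hδ] at hH'
  rw [hab, gram_mul_formElement_add hε hδ] at hH
  rw [hab] at hinv'
  obtain ⟨d1, d2⟩ := formElement_det_eqs hε hδ hinv'
  refine involution_parameters_contradiction α β ε hε δ hδ p q d1 k l d2 (fun hα0 => ?_)
    fun _ c1 c2 => diagValue_add_eq_zero c1 c2 hC.1 hH'
  have hα1 := sq_eq_one_of_ne_zero hα0
  exact diagValue_add_eq_zero (by linear_combination d1 - hα1) (by linear_combination d2 - hα1)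
    hA.1 hH

end ExceptionalSymplectic

/-! ### Adapted bases and the passage to matrices -/

namespace ExceptionalSymplectic

theorem nonempty_ringEquiv_zmod_three {F : Type*} [Field F] (hF : Nat.card F = 3) :
    Nonempty (F ≃+* ZMod 3) := by
  have : Finite F := Nat.finite_of_card_ne_zero (by omega)
  have : Fintype F := Fintype.ofFinite F
  exact ⟨(ZMod.ringEquivOfPrime F Nat.prime_three (by rw [← Nat.card_eq_fintype_card, hF])).symm⟩

variable {F V : Type*} [Field F] [AddCommGroup V] [Module F V]

/-- A basis in which `v` is the sum of a quarter turn and a transvection, and in which `s` is an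
orthogonal sum of two planes. -/
structure IsAdapted (s : LinearMap.BilinForm F V) (v : Module.End F V)
    (b : Module.Basis (Fin 4) F V) : Prop where
  apply_zero : v (b 0) = b 1
  apply_one : v (b 1) = -b 0
  apply_two : v (b 2) = b 2 + b 3
  apply_three : v (b 3) = b 3
  ortho : s (b 0) (b 2) = 0 ∧ s (b 0) (b 3) = 0 ∧ s (b 1) (b 2) = 0 ∧ s (b 1) (b 3) = 0
  ne_zero : s (b 0) (b 1) ≠ 0
  ne_zero' : s (b 2) (b 3) ≠ 0

theorem exists_isAdapted [FiniteDimensional F V] (h3 : (3 : F) = 0) {s : LinearMap.BilinForm F V}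
    (hs : IsSymplecticForm s) {v : Module.End F V} (hv : ∀ x y, s (v x) (v y) = s x y)
    {x : V} (hx : Submodule.span F (Set.range fun n : ℕ => (v ^ n) x) = ⊤)
    (hp : (v ^ 2 + 1) * (v - 1) ^ 2 = 0) (hd : 4 ≤ Module.finrank F V) :
    ∃ b : Module.Basis (Fin 4) F V, IsAdapted s v b := by
  have h2 : (2 : F) ≠ 0 := by
    intro h
    exact one_ne_zero (α := F) (by linear_combination h3 - h)
  have h3V : ∀ y : V, (3 : F) • y = 0 := fun y => by rw [h3, zero_smul]
  set e : Fin 4 → V := ![((v - 1) ^ 2 : Module.End F V) x, v (((v - 1) ^ 2 : Module.End F V) x),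
    (v ^ 2 + 1 : Module.End F V) x, (v - 1) ((v ^ 2 + 1 : Module.End F V) x)] with he
  have hpx : ((v ^ 2 + 1) * (v - 1) ^ 2 : Module.End F V) x = 0 := by rw [hp]; rfl
  have hpx' : ((v - 1) ^ 2 * (v ^ 2 + 1) : Module.End F V) x = 0 := by
    rw [show (v - 1) ^ 2 * (v ^ 2 + 1) = (v ^ 2 + 1) * (v - 1) ^ 2 by noncomm_ring, hp]; rfl
  have m0 : v (e 0) = e 1 := rfl
  have m1 : v (e 1) = -e 0 := by
    simp only [Module.End.mul_apply, LinearMap.add_apply, Module.End.one_apply] at hpx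
    exact eq_neg_of_add_eq_zero_left hpx
  have m2 : v (e 2) = e 2 + e 3 := by simp [he]
  have m3 : v (e 3) = e 3 := by
    rw [pow_two (v - 1), Module.End.mul_apply, Module.End.mul_apply] at hpx'
    exact sub_eq_zero.mp hpx'
  -- Bézout: `-(t² + 1) + (t - 1)(t² + 1) - t(t - 1)² = -2`, which is 1 in characteristic 3.
  have hxe : x = -e 2 + e 3 - e 1 := by
    have : x - (-e 2 + e 3 - e 1) = (3 : F) • x := by
      simp only [he, Matrix.cons_val, pow_two, Module.End.mul_apply, LinearMap.sub_apply,
        LinearMap.add_apply, Module.End.one_apply, map_sub, map_add]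
      module
    exact sub_eq_zero.mp (this.trans (h3V x))
  have hspan : ⊤ ≤ Submodule.span F (Set.range e) := by
    rw [← hx, Submodule.span_le]
    have hmem : ∀ i, e i ∈ Submodule.span F (Set.range e) :=
      fun i => Submodule.subset_span ⟨i, rfl⟩
    have hstab : ∀ y ∈ Submodule.span F (Set.range e), v y ∈ Submodule.span F (Set.range e) := by
      intro y hy
      have : Submodule.span F (Set.range e) ≤ (Submodule.span F (Set.range e)).comap v := by
        rw [Submodule.span_le]
        rintro _ ⟨i, rfl⟩
        fin_cases i
        · change v (e 0) ∈ Submodule.span F (Set.range e)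
          rw [m0]; exact hmem 1
        · change v (e 1) ∈ Submodule.span F (Set.range e)
          rw [m1]; exact neg_mem (hmem 0)
        · change v (e 2) ∈ Submodule.span F (Set.range e)
          rw [m2]; exact add_mem (hmem 2) (hmem 3)
        · change v (e 3) ∈ Submodule.span F (Set.range e)
          rw [m3]; exact hmem 3
      exact this hy
    rintro _ ⟨n, rfl⟩
    induction n with
    | zero =>
      simp only [pow_zero, Module.End.one_apply]
      rw [hxe]
      exact sub_mem (add_mem (neg_mem (hmem 2)) (hmem 3)) (hmem 1)
    | succ n ih =>
      simp only [pow_succ', Module.End.mul_apply]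
      exact hstab _ ih
  have hcard : Fintype.card (Fin 4) = Module.finrank F V := by
    refine le_antisymm (by simpa using hd) ?_
    rw [← finrank_top, ← top_le_iff.mp hspan]
    exact finrank_range_le_card e
  set b := basisOfTopLeSpanOfCardEqFinrank e hspan hcard with hb
  have hbe : ∀ i, b i = e i := fun i => by rw [hb, coe_basisOfTopLeSpanOfCardEqFinrank]
  -- Applying `v` twice negates `e 0` and fixes `e 3`.
  have o03 : s (e 0) (e 3) = 0 := by
    have a1 := hv (e 0) (e 3)
    have a2 := hv (e 1) (e 3)
    simp only [m0, m1, m3, map_neg, LinearMap.neg_apply] at a1 a2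
    exact (mul_eq_zero.mp (show (2 : F) * s (e 0) (e 3) = 0 by
      linear_combination -a1 - a2)).resolve_left h2
  have o13 : s (e 1) (e 3) = 0 := by
    have a1 := hv (e 0) (e 3)
    rw [m0, m3] at a1
    rw [a1, o03]
  have o02 : s (e 0) (e 2) = 0 := by
    have a1 := hv (e 0) (e 2)
    have a2 := hv (e 1) (e 2)
    simp only [m0, m1, m2, map_neg, map_add, LinearMap.neg_apply] at a1 a2
    exact (mul_eq_zero.mp (show (2 : F) * s (e 0) (e 2) = 0 by
      linear_combination -a1 - a2 + o13 - o03)).resolve_left h2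
  have o12 : s (e 1) (e 2) = 0 := by
    have a1 := hv (e 0) (e 2)
    rw [m0, m2, map_add, o13, add_zero] at a1
    rw [a1, o02]
  have hnd : ∀ i, ¬ ∀ j, s (b i) (b j) = 0 := by
    intro i hi
    refine b.ne_zero i (hs.2.1 (b i) fun y => ?_)
    have : s (b i) = 0 := b.ext fun j => by simpa using hi j
    rw [this]; rfl
  have skew : ∀ y z, s y z = -s z y := fun y z => (hs.1.neg_eq z y).symm
  refine ⟨b, ⟨?_, ?_, ?_, ?_, ?_, ?_, ?_⟩⟩
  · rw [hbe, hbe, m0]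
  · rw [hbe, hbe, m1]
  · rw [hbe, hbe, m2]
  · rw [hbe, m3]
  · simp only [hbe]
    exact ⟨o02, o03, o12, o13⟩
  · intro h
    refine hnd 0 fun j => ?_
    simp only [hbe] at h ⊢
    fin_cases j
    exacts [hs.1 _, h, o02, o03]
  · intro h
    refine hnd 2 fun j => ?_
    simp only [hbe] at h ⊢
    fin_cases j
    exacts [by simp [skew (e 2) (e 0), o02], by simp [skew (e 2) (e 1), o12], hs.1 _, h]

/-- The matrix of an endomorphism, transported to `ZMod 3`. -/
noncomputable def zmodMatrix (e : F ≃+* ZMod 3) (b : Module.Basis (Fin 4) F V) :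
    Module.End F V →+* Matrix (Fin 4) (Fin 4) (ZMod 3) :=
  e.toRingHom.mapMatrix.comp (LinearMap.toMatrixAlgEquiv b).toRingEquiv.toRingHom

theorem zmodMatrix_apply (e : F ≃+* ZMod 3) (b : Module.Basis (Fin 4) F V)
    (f : Module.End F V) (i j : Fin 4) : zmodMatrix e b f i j = e (b.repr (f (b j)) i) := by
  simp [zmodMatrix, LinearMap.toMatrixAlgEquiv_apply]

theorem IsAdapted.zmodMatrix_eq {s : LinearMap.BilinForm F V} {v : Module.End F V}
    {b : Module.Basis (Fin 4) F V} (h : IsAdapted s v b) (e : F ≃+* ZMod 3) :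
    zmodMatrix e b v = turnTransvection := by
  ext i j
  rw [zmodMatrix_apply]
  fin_cases i <;> fin_cases j <;>
    simp [h.apply_zero, h.apply_one, h.apply_two, h.apply_three, turnTransvection]

theorem IsAdapted.isSymplecticInvolution {s : LinearMap.BilinForm F V} (hs : IsSymplecticForm s)
    {v : Module.End F V}
    {b : Module.Basis (Fin 4) F V} (h : IsAdapted s v b) (e : F ≃+* ZMod 3)
    {i : Module.End F V} (hi : i * i = 1) (his : ∀ x y, s (i x) (i y) = s x y) :
    IsSymplecticInvolution (e (s (b 0) (b 1))) (e (s (b 2) (b 3))) (zmodMatrix e b i) := by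
  have skew : ∀ y z, s y z = -s z y := fun y z => (hs.1.neg_eq z y).symm
  refine ⟨by rw [← map_mul, hi, map_one], ?_⟩
  have hg : gram (e (s (b 0) (b 1))) (e (s (b 2) (b 3))) =
      e.toRingHom.mapMatrix (LinearMap.BilinForm.toMatrix b s) := by
    obtain ⟨o1, o2, o3, o4⟩ := h.ortho
    ext i j
    fin_cases i <;> fin_cases j <;>
      simp [gram, LinearMap.BilinForm.toMatrix_apply, hs.1.self_eq_zero, o1, o2, o3, o4,
        skew (b 1) (b 0), skew (b 3) (b 2), skew (b 2) (b 0), skew (b 2) (b 1),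
        skew (b 3) (b 0), skew (b 3) (b 1)]
  have hc : s.comp i i = s := by ext x y; exact his x y
  have := congrArg e.toRingHom.mapMatrix
    ((LinearMap.BilinForm.toMatrix_comp b b s i i).symm.trans (by rw [hc]))
  rw [map_mul, map_mul] at this
  rw [hg]
  refine Eq.trans ?_ this
  rfl

theorem not_isReflectional_four [FiniteDimensional F V] (hF : Nat.card F = 3)
    {s : LinearMap.BilinForm F V} (hs : IsSymplecticForm s) {η : F} (hη : η = 1 ∨ η = -1)
    {u : symplecticGroupOf s}
    (hu : IsExceptionalCyclic η (u : V ≃ₗ[F] V).toLinearMap) : ¬ IsReflectional 4 u := by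
  rintro ⟨i, hi, hprod⟩
  obtain ⟨e⟩ := nonempty_ringEquiv_zmod_three hF
  have h3 : (3 : F) = 0 := e.injective (by rw [map_zero]; exact map_ofNat e 3)
  obtain ⟨⟨x, hx⟩, hmin⟩ := hu
  have hηη : η * η = 1 := by rcases hη with rfl | rfl <;> simp
  set f : symplecticGroupOf s → Module.End F V := fun g => (g : V ≃ₗ[F] V).toLinearMap with hf
  have hd : 4 ≤ Module.finrank F V := by
    have h1 : (minpoly F (f u)).natDegree = 4 := by
      rw [hmin]
      compute_degree!
    rw [← h1, ← LinearMap.charpoly_natDegree (f u)]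
    exact Polynomial.natDegree_le_of_dvd (LinearMap.minpoly_dvd_charpoly _)
      (LinearMap.charpoly_monic _).ne_zero
  have hp : (f u ^ 2 + 1) * (f u - algebraMap F _ η) ^ 2 = 0 := by
    have := minpoly.aeval F (f u)
    rw [hmin] at this
    simpa using this
  have hsq : ∀ {w : Module.End F V}, (η • w) * (η • w) = w * w := by
    intro w
    rw [smul_mul_smul_comm, hηη, one_smul]
  obtain ⟨b, hb⟩ := exists_isAdapted h3 hs (v := η • f u) (x := x)
    (fun y z => by
      simp only [LinearMap.smul_apply, map_smul, smul_eq_mul, ← mul_assoc, hηη, one_mul]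
      exact u.2 y z)
    (by
      rw [← top_le_iff, ← hx, Submodule.span_le]
      rintro _ ⟨n, rfl⟩
      have : (f u ^ n) x = η ^ n • ((η • f u) ^ n) x := by
        rw [_root_.smul_pow, LinearMap.smul_apply, smul_smul, ← mul_pow, hηη, one_pow, one_smul]
      change (f u ^ n) x ∈ _
      rw [this]
      exact Submodule.smul_mem _ _ (Submodule.subset_span ⟨n, rfl⟩))
    (by
      have h1 : η • f u - 1 = η • (f u - algebraMap F _ η) := by
        rw [smul_sub, Algebra.algebraMap_eq_smul_one, smul_smul, hηη, one_smul]
      rw [h1, pow_two, pow_two, hsq, hsq, ← pow_two, ← pow_two, hp]) hd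
  set ψ : symplecticGroupOf s → _ := fun g => zmodMatrix e b (f g)
  have hψ : ∀ g h, ψ (g * h) = ψ g * ψ h := fun g h => map_mul (zmodMatrix e b) (f g) (f h)
  have hinv : ∀ j, IsSymplecticInvolution (e (s (b 0) (b 1))) (e (s (b 2) (b 3))) (ψ (i j)) := by
    intro j
    refine hb.isSymplecticInvolution hs e ?_ (i j).2
    have := hi j
    rw [pow_two] at this
    exact congrArg f this
  have hU : e η • ψ u = turnTransvection := by
    rw [← hb.zmodMatrix_eq e]
    ext i j
    simp [ψ, zmodMatrix_apply]
  have hprod' : ψ u = ψ (i 0) * ψ (i 1) * ψ (i 2) * ψ (i 3) := by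
    rw [← hprod, ← hψ, ← hψ, ← hψ]
    simp [List.ofFn_succ, mul_assoc]
  have he0 : e (s (b 0) (b 1)) ≠ 0 := by simpa using hb.ne_zero
  have he1 : e (s (b 2) (b 3)) ≠ 0 := by simpa using hb.ne_zero'
  rcases hη with rfl | rfl
  · refine turnTransvection_ne_mul_four he0 he1 (hinv 0) (hinv 1) (hinv 2) (hinv 3) ?_
    rw [← hprod', ← hU, map_one, one_smul]
  -- The sign `η = -1` is absorbed into the first involution.
  · refine turnTransvection_ne_mul_four he0 he1 (hinv 0).neg (hinv 1) (hinv 2) (hinv 3) ?_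
    rw [← hU, hprod', map_neg, map_one]
    simp

end ExceptionalSymplectic

/-! ### Existence of exceptional elements and the length bound -/

namespace ExceptionalSymplectic

variable {F V : Type*} [Field F] [AddCommGroup V] [Module F V]

theorem isReflectional_mono {G : Type*} [Group G] {k m : ℕ} {g : G} (h : IsReflectional k g)
    (hkm : k ≤ m) : IsReflectional m g := by
  induction m, hkm using Nat.le_induction with
  | base => exact h
  | succ m _ ih =>
    obtain ⟨i, hi, hprod⟩ := ih
    refine ⟨Fin.cons 1 i, fun j => ?_, ?_⟩
    · refine Fin.cases ?_ (fun j => ?_) j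
      · simp
      · simpa using hi j
    · simpa [List.ofFn_succ] using hprod

theorem exists_apply_eq_one {s : LinearMap.BilinForm F V} (hs : IsSymplecticForm s) {x : V}
    (hx : x ≠ 0) : ∃ y, s x y = 1 := by
  obtain ⟨y, hy⟩ : ∃ y, s x y ≠ 0 := by
    by_contra! h
    exact hx (hs.2.1 x h)
  exact ⟨(s x y)⁻¹ • y, by simp [hy]⟩

theorem exists_symplectic_basis [FiniteDimensional F V] {s : LinearMap.BilinForm F V}
    (hs : IsSymplecticForm s) (hd : Module.finrank F V = 4) :
    ∃ b : Module.Basis (Fin 4) F V, s (b 0) (b 1) = 1 ∧ s (b 2) (b 3) = 1 ∧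
      s (b 0) (b 2) = 0 ∧ s (b 0) (b 3) = 0 ∧ s (b 1) (b 2) = 0 ∧ s (b 1) (b 3) = 0 := by
  have skew : ∀ y z, s y z = -s z y := fun y z => (hs.1.neg_eq z y).symm
  have : Nontrivial V := Module.nontrivial_of_finrank_pos (R := F) (by omega)
  obtain ⟨x, hx⟩ := exists_ne (0 : V)
  obtain ⟨y, hxy⟩ := exists_apply_eq_one hs hx
  obtain ⟨z, hz, hz0⟩ : ∃ z ∈ LinearMap.ker ((s x).prod (s y)), z ≠ 0 := by
    apply Submodule.exists_mem_ne_zero_of_ne_bot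
    apply LinearMap.ker_ne_bot_of_finrank_lt
    simp [hd]
  obtain ⟨hxz, hyz⟩ : s x z = 0 ∧ s y z = 0 := by simpa using hz
  obtain ⟨w, hzw⟩ := exists_apply_eq_one hs hz0
  have hyx : s y x = -1 := by rw [skew, hxy]
  have hzx : s z x = 0 := by rw [skew, hxz, neg_zero]
  have hzy : s z y = 0 := by rw [skew, hyz, neg_zero]
  -- Gram–Schmidt correction making `w'` orthogonal to the plane of `x` and `y`.
  set w' := w + s y w • x - s x w • y with hw'
  have hzw' : s z w' = 1 := by simp [hw', hzw, hzx, hzy]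
  have hxw' : s x w' = 0 := by simp [hw', hs.1.self_eq_zero, hxy]
  have hyw' : s y w' = 0 := by simp [hw', hs.1.self_eq_zero, hyx]
  have hwx : s w' x = 0 := by rw [skew, hxw', neg_zero]
  have hwy : s w' y = 0 := by rw [skew, hyw', neg_zero]
  have hwz : s w' z = -1 := by rw [skew, hzw']
  have hli : LinearIndependent F ![x, y, z, w'] := by
    rw [Fintype.linearIndependent_iff]
    intro g hg
    simp only [Fin.sum_univ_four, Matrix.cons_val] at hg
    have p := fun t => congrArg (s t) hg
    simp only [map_add, map_smul, map_zero, smul_eq_mul] at p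
    have p0 := p x
    have p1 := p y
    have p2 := p z
    have p3 := p w'
    simp only [hs.1.self_eq_zero, hxy, hxz, hxw', hyx, hyz, hyw', hzx, hzy, hzw', hwx, hwy, hwz]
      at p0 p1 p2 p3
    intro i
    fin_cases i
    · simpa using p1
    · simpa using p0
    · simpa using p3
    · simpa using p2
  refine ⟨basisOfLinearIndependentOfCardEqFinrank hli (by simp [hd]), ?_⟩
  simp only [coe_basisOfLinearIndependentOfCardEqFinrank]
  exact ⟨hxy, hzw', hxz, hxw', hyz, hyw'⟩

/-- Spanning by `n = dim V` iterates makes them independent, so no nonzero polynomial of degree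
below `n` annihilates `f`. -/
theorem minpoly_eq_of_span_iterates [FiniteDimensional F V] (f : Module.End F V) (x : V)
    {n : ℕ} (hd : Module.finrank F V = n)
    (hx : Submodule.span F (Set.range fun i : Fin n => (f ^ (i : ℕ)) x) = ⊤) {p : F[X]}
    (hp : p.Monic) (hpn : p.natDegree = n) (hpf : aeval f p = 0) : minpoly F f = p := by
  have hli := linearIndependent_of_top_le_span_of_card_eq_finrank hx.ge (by simp [hd])
  refine (minpoly.unique F f hp hpf fun q hq hqf => ?_).symm
  rw [degree_eq_natDegree hp.ne_zero, degree_eq_natDegree hq.ne_zero, hpn]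
  by_contra! hlt
  have hlt' : q.natDegree < n := by exact_mod_cast hlt
  rw [Fintype.linearIndependent_iff] at hli
  have h0 := hli (fun i => q.coeff i) (by
    rw [Fin.sum_univ_eq_sum_range (fun i => q.coeff i • (f ^ i) x)]
    have := congrArg (fun g : Module.End F V => g x) hqf
    rw [aeval_eq_sum_range' hlt'] at this
    simpa using this) ⟨q.natDegree, hlt'⟩
  exact one_ne_zero (hq.coeff_natDegree.symm.trans h0)

theorem exists_isExceptionalCyclic [FiniteDimensional F V] (h3 : (3 : F) = 0)
    {s : LinearMap.BilinForm F V} (hs : IsSymplecticForm s) (hd : Module.finrank F V = 4)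
    {η : F} (hη : η * η = 1) :
    ∃ u : symplecticGroupOf s, IsExceptionalCyclic η (u : V ≃ₗ[F] V).toLinearMap := by
  have skew : ∀ y z, s y z = -s z y := fun y z => (hs.1.neg_eq z y).symm
  obtain ⟨b, h01, h23, h02, h03, h12, h13⟩ := exists_symplectic_basis hs hd
  -- A quarter turn on one plane and a Jordan block of eigenvalue `η` on the other; `b 0 + b 2` is a
  -- cyclic vector.
  set f : Module.End F V := b.constr F ![b 1, -b 0, η • b 2 + b 3, η • b 3] with hf
  have f0 : f (b 0) = b 1 := by simp [hf]
  have f1 : f (b 1) = -b 0 := by simp [hf]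
  have f2 : f (b 2) = η • b 2 + b 3 := by simp [hf]
  have f3 : f (b 3) = η • b 3 := by simp [hf]
  have hfs : ∀ x y, s (f x) (f y) = s x y := by
    have : s.comp f f = s := by
      refine LinearMap.BilinForm.ext_basis b fun i j => ?_
      rw [LinearMap.BilinForm.comp_apply]
      fin_cases i <;> fin_cases j <;>
        simp [f0, f1, f2, f3, hs.1.self_eq_zero, h01, h23, h02, h03, h12, h13, hη,
        skew (b 1) (b 0), skew (b 3) (b 2), skew (b 2) (b 0), skew (b 2) (b 1),
        skew (b 3) (b 0), skew (b 3) (b 1)]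
    intro x y
    exact congrArg (fun t : LinearMap.BilinForm F V => t x y) this
  have hinj : Function.Injective f := by
    rw [← LinearMap.ker_eq_bot, LinearMap.ker_eq_bot']
    intro x hx
    exact hs.2.1 x fun y => by rw [← hfs, hx, map_zero, LinearMap.zero_apply]
  refine ⟨⟨LinearEquiv.ofInjectiveEndo f hinj, hfs⟩, ?_⟩
  have hco : (LinearEquiv.ofInjectiveEndo f hinj).toLinearMap = f := by ext; rfl
  change IsExceptionalCyclic η (LinearEquiv.ofInjectiveEndo f hinj).toLinearMap
  rw [hco]
  have hspan : Submodule.span F (Set.range fun i : Fin 4 => (f ^ (i : ℕ)) (b 0 + b 2)) = ⊤ := by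
    set S := Submodule.span F (Set.range fun i : Fin 4 => (f ^ (i : ℕ)) (b 0 + b 2)) with hS
    have hmem : ∀ i : Fin 4, (f ^ (i : ℕ)) (b 0 + b 2) ∈ S :=
      fun i => Submodule.subset_span ⟨i, rfl⟩
    have g0 : b 0 + b 2 ∈ S := hmem 0
    have g1 : b 1 + η • b 2 + b 3 ∈ S := by
      have := hmem 1
      simpa [f0, f2, add_assoc] using this
    have g2 : -b 0 + b 2 + (2 * η) • b 3 ∈ S := by
      have := hmem 2
      simp only [Fin.val_two, pow_two, Module.End.mul_apply, map_add, map_smul, f0, f1, f2, f3,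
        smul_add, smul_smul, hη, one_smul] at this
      convert this using 1
      module
    have g3 : -b 1 + η • b 2 ∈ S := by
      have := hmem 3
      simp only [show ((3 : Fin 4) : ℕ) = 3 from rfl, pow_three, Module.End.mul_apply, map_add,
        map_smul, map_neg, f0, f1, f2, f3, smul_add, smul_smul, hη, one_smul] at this
      convert this using 1
      match_scalars <;> grind
    have k3 : b 3 ∈ S := by
      have := sub_mem (Submodule.smul_mem S η (add_mem g0 g2)) (add_mem g1 g3)
      convert this using 1
      match_scalars <;> grind
    have k2 : b 2 ∈ S := by
      have := neg_mem (add_mem (add_mem g0 g2) (Submodule.smul_mem S η k3))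
      convert this using 1
      match_scalars <;> grind
    have k0 : b 0 ∈ S := by simpa using sub_mem g0 k2
    have k1 : b 1 ∈ S := by
      simpa [add_assoc] using sub_mem g1 (add_mem (Submodule.smul_mem S η k2) k3)
    rw [← top_le_iff, ← b.span_eq, Submodule.span_le]
    rintro _ ⟨i, rfl⟩
    fin_cases i
    exacts [k0, k1, k2, k3]
  refine ⟨⟨b 0 + b 2, ?_⟩, ?_⟩
  · rw [← top_le_iff, ← hspan, Submodule.span_le]
    rintro _ ⟨i, rfl⟩
    exact Submodule.subset_span ⟨i, rfl⟩
  · refine minpoly_eq_of_span_iterates f (b 0 + b 2) hd hspan (by monicity!) (by compute_degree!) ?_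
    refine b.ext fun i => ?_
    simp only [map_mul, map_add, map_pow, aeval_X, map_one, map_sub, aeval_C,
      Algebra.algebraMap_eq_smul_one]
    fin_cases i <;> simp [pow_two, f0, f1, f2, f3, smul_smul, hη] <;> match_scalars <;> grind

end ExceptionalSymplectic

open ExceptionalSymplectic in
theorem mainTheorem5 {F V : Type*} [Field F] (hF : Nat.card F = 3)
    [AddCommGroup V] [Module F V] [FiniteDimensional F V]
    (s : LinearMap.BilinForm F V) (hs : IsSymplecticForm s) :
    (∀ (η : F) (u : symplecticGroupOf s), (η = 1 ∨ η = -1) →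
        IsExceptionalCyclic η (u : V ≃ₗ[F] V).toLinearMap → ¬ IsReflectional 4 u) ∧
      (Module.finrank F V = 4 →
        (∀ η : F, (η = 1 ∨ η = -1) →
          ∃ u : symplecticGroupOf s, IsExceptionalCyclic η (u : V ≃ₗ[F] V).toLinearMap) ∧
        (∃ u : symplecticGroupOf s, ¬ IsReflectional 4 u) ∧
        4 < involutionLength (symplecticGroupOf s)) := by
  refine ⟨fun η u hη hu => not_isReflectional_four hF hs hη hu, fun hd => ?_⟩
  have h3 : (3 : F) = 0 := by
    obtain ⟨e⟩ := nonempty_ringEquiv_zmod_three hF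
    exact e.injective (by rw [map_zero]; exact map_ofNat e 3)
  have hex : ∀ η : F, (η = 1 ∨ η = -1) →
      ∃ u : symplecticGroupOf s, IsExceptionalCyclic η (u : V ≃ₗ[F] V).toLinearMap :=
    fun η hη => exists_isExceptionalCyclic h3 hs hd (by rcases hη with rfl | rfl <;> simp)
  obtain ⟨u, hu⟩ := hex 1 (Or.inl rfl)
  have hnot := not_isReflectional_four hF hs (Or.inl rfl) hu
  refine ⟨hex, ⟨u, hnot⟩, ?_⟩
  have hle : (5 : ℕ∞) ≤ involutionLength (symplecticGroupOf s) := by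
    refine le_sInf ?_
    rintro _ ⟨k, rfl, hk⟩
    by_contra! hlt
    have hk4 : k ≤ 4 := by
      have : k < 5 := by exact_mod_cast hlt
      omega
    exact hnot (isReflectional_mono (hk u) hk4)
  exact lt_of_lt_of_le (by norm_num) hle
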